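/- A \emph{generalized measurement theory} (GMT) is a functor $M\colon \mathsf{FinSet}\to\mathsf{Set}$ such that $M(1)$ is a singleton, where $1$ is a one-point set. For a function $f\colon X\to Y$ of finite sets and $\alpha\in M(X)$ write $f_*\alpha := M(f)(\alpha)$. Two GMTs are \emph{isomorphic} if they are naturally isomorphic as functors. A GMT $M$ is \emph{strongly classical} if for every finite family $(\alpha_i\in M(X_i))_{i=1}^n$, with $X_1,\dots,X_n$ finite sets, there are a finite set $Y$, functions $f_i\colon Y\to X_i$ and $\beta\in M(Y)$ such that $f_{i,*}\beta=\alpha_i$ for all $i$, and such that for every finite set $Z$, every $\gamma\in M(Z)$ and all functions $g_i\colon Z\to X_i$ with $g_{i,*}\gamma=\alpha_i$ for all $i$, there is a unique function $h\colon Z\to Y$ with $g_i=f_i\circ h$ for all $i$ and $\beta=h_*\gamma$. (That is, finite products exist in the category of elements of $M$.) A GMT $M$ is \emph{projective} if for all finite sets $X,Y$, all $\alpha\in M(X)$ and all functions $f,g\colon X\to Y$ with $f_*\alpha=g_*\alpha$, there are a finite set $E$, $\sigma\in M(E)$ and $e\colon E\to X$ with $f\circ e=g\circ e$ and $e_*\sigma=\alpha$,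 such that for every finite set $E'$, every $\sigma'\in M(E')$ and every $e'\colon E'\to X$ with $f\circ e'=g\circ e'$ and $e'_*\sigma'=\alpha$, there is a unique function $h\colon E'\to E$ with $e'=e\circ h$ and $\sigma=h_*\sigma'$. (That is, equalizers exist in the category of elements of $M$.) For a Boolean algebra $B$ (the one-element Boolean algebra, in which $0=1$, is allowed), let $M_B$ be the GMT for which $M_B(X)$ is the set of $X$-indexed partitions of unity in $B$, that is, of families $(b_x)_{x\in X}$ of pairwise disjoint (possibly zero) elements of $B$ with $\bigvee_{x\in X}b_x=1$, and for which $(f_*b)_y=\bigvee_{x\in f^{-1}(y)}b_x$ for $f\colon X\to Y$ and $y\in Y$. \textbf{Theorem.} For every GMT $M$, the following are equivalent: \begin{enumerate} \item $M$ is strongly classical and projective. \item $M$ is isomorphic to $M_B$ for some Boolean algebra $B$. \end{enumerate} -/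

import Mathlib

open CategoryTheory

universe u

/-- A generalized measurement theory: a functor `M : FinSet ⥤ Set` with `M(1) ≅ 1`. -/
structure GMT where
  /-- The underlying functor. -/
  functor : FintypeCat.{u} ⥤ Type u
  /-- There is exactly one measurement with values in a one-point set. -/
  affine : Nonempty (functor.obj (FintypeCat.of PUnit.{u + 1}) ≃ PUnit.{u + 1})

namespace GMT

/-- The set `M(X)` of measurements with outcomes in the finite set `X`. -/
abbrev Meas (M : GMT.{u}) (X : FintypeCat.{u}) : Type u := M.functor.obj X

/-- Post-processing `f_* α = M(f)(α)`. -/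
abbrev push (M : GMT.{u}) {X Y : FintypeCat.{u}} (f : X ⟶ Y) (α : M.Meas X) : M.Meas Y :=
  M.functor.map f α

/-- A finite family of measurements `α i ∈ M(X i)` is strongly compatible if there is a universal
measurement `β ∈ M(Y)`, with functions `f i : Y ⟶ X i`, that post-processes to all the `α i`. -/
def StronglyCompatible (M : GMT.{u}) {n : ℕ} (X : Fin n → FintypeCat.{u})
    (α : ∀ i, M.Meas (X i)) : Prop :=
  ∃ (Y : FintypeCat.{u}) (f : ∀ i, Y ⟶ X i) (β : M.Meas Y),
    (∀ i, α i = M.push (f i) β) ∧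
    ∀ (Z : FintypeCat.{u}) (γ : M.Meas Z) (g : ∀ i, Z ⟶ X i),
      (∀ i, M.push (g i) γ = α i) →
      ∃! h : Z ⟶ Y, (∀ i, g i = h ≫ f i) ∧ β = M.push h γ

/-- Any finitely many measurements are strongly compatible. -/
def StronglyClassical (M : GMT.{u}) : Prop :=
  ∀ (n : ℕ) (X : Fin n → FintypeCat.{u}) (α : ∀ i, M.Meas (X i)), M.StronglyCompatible X α

/-- Whenever `f_* α = g_* α`, there is a universal measurement `σ ∈ M(E)` with a function
`e : E ⟶ X` equalizing `f` and `g` such that `e_* σ = α`. -/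
def Projective (M : GMT.{u}) : Prop :=
  ∀ (X Y : FintypeCat.{u}) (α : M.Meas X) (f g : X ⟶ Y), M.push f α = M.push g α →
    ∃ (E : FintypeCat.{u}) (σ : M.Meas E) (e : E ⟶ X),
      (e ≫ f = e ≫ g ∧ M.push e σ = α) ∧
      ∀ (E' : FintypeCat.{u}) (σ' : M.Meas E') (e' : E' ⟶ X),
        e' ≫ f = e' ≫ g → M.push e' σ' = α →
        ∃! h : E' ⟶ E, e' = h ≫ e ∧ σ = M.push h σ'

/-- Isomorphism of GMTs: a natural isomorphism of the underlying functors. -/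
def Isomorphic (M N : GMT.{u}) : Prop := Nonempty (M.functor ≅ N.functor)

end GMT

section PartitionOfUnity

variable {B : Type u} [BooleanAlgebra B]

/-- The finite join `⋁_{x ∈ s} a x`. -/
noncomputable def joinOn {X : Type u} [Finite X] (s : Set X) (a : X → B) : B :=
  (Set.toFinite s).toFinset.sup a

theorem joinOn_le_iff {X : Type u} [Finite X] {s : Set X} {a : X → B} {b : B} :
    joinOn s a ≤ b ↔ ∀ x ∈ s, a x ≤ b := by
  simp [joinOn]

theorem le_joinOn {X : Type u} [Finite X] {s : Set X} (a : X → B) {x : X} (hx : x ∈ s) :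
    a x ≤ joinOn s a :=
  joinOn_le_iff.1 le_rfl x hx

variable (B) in
/-- Partitions of unity in `B` indexed by `X`: families of pairwise disjoint elements (possibly
`⊥`) with join `⊤`. -/
@[ext]
structure UnityPartition (X : Type u) [Finite X] where
  /-- The members of the family. -/
  part : X → B
  disjoint : ∀ x y, x ≠ y → Disjoint (part x) (part y)
  join_eq_top : joinOn Set.univ part = ⊤

/-- Post-processing along `f`: the family `y ↦ ⋁_{x ∈ f⁻¹(y)} a x`. -/
noncomputable def UnityPartition.push {X Y : Type u} [Finite X] [Finite Y] (f : X → Y)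
    (a : UnityPartition B X) : UnityPartition B Y where
  part y := joinOn (f ⁻¹' {y}) a.part
  disjoint y z hyz := by
    simp only [joinOn, Finset.disjoint_sup_left, Finset.disjoint_sup_right]
    intro x hx w hw
    simp only [Set.Finite.mem_toFinset, Set.mem_preimage, Set.mem_singleton_iff] at hx hw
    exact a.disjoint _ _ (by rintro rfl; exact hyz (by simp_all))
  join_eq_top := by
    refine top_le_iff.1 (a.join_eq_top ▸ joinOn_le_iff.2 fun x _ => ?_)
    exact (le_joinOn (s := f ⁻¹' {f x}) a.part rfl).trans
      (le_joinOn (fun y => joinOn (f ⁻¹' {y}) a.part) (Set.mem_univ (f x)))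

theorem UnityPartition.push_id {X : Type u} [Finite X] (a : UnityPartition B X) :
    a.push (fun x => x) = a := by
  ext x
  refine le_antisymm (joinOn_le_iff.2 ?_) (le_joinOn a.part rfl)
  rintro y rfl
  exact le_rfl

theorem UnityPartition.push_push {X Y Z : Type u} [Finite X] [Finite Y] [Finite Z]
    (f : X → Y) (g : Y → Z) (a : UnityPartition B X) :
    (a.push f).push g = a.push (fun x => g (f x)) := by
  ext z
  refine le_antisymm (joinOn_le_iff.2 ?_) (joinOn_le_iff.2 ?_)
  · rintro y rfl
    refine joinOn_le_iff.2 ?_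
    rintro x rfl
    exact le_joinOn a.part rfl
  · rintro x rfl
    exact (le_joinOn (s := f ⁻¹' {f x}) a.part rfl).trans
      (le_joinOn (s := g ⁻¹' {g (f x)}) (a.push f).part rfl)

end PartitionOfUnity

/-- The GMT `M_B` of a Boolean algebra `B`: `M_B(X)` is the set of partitions of unity in `B`
indexed by `X`. -/
noncomputable def booleanGMT (B : Type u) [BooleanAlgebra B] : GMT.{u} where
  functor :=
    { obj := fun X => UnityPartition B X
      map := fun {X Y} f => TypeCat.ofHom (UnityPartition.push (fun x : X => (f x : Y)))
      map_id := fun X => by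
        apply ConcreteCategory.hom_ext
        intro a
        exact UnityPartition.push_id (X := X) a
      map_comp := fun {X Y Z} f g => by
        apply ConcreteCategory.hom_ext
        intro a
        exact (UnityPartition.push_push (fun x : X => (f x : Y)) (fun y : Y => (g y : Z)) a).symm }
  affine := by
    refine ⟨⟨fun _ => PUnit.unit, fun _ => ⟨fun _ => ⊤, fun x y h => (h rfl).elim, ?_⟩, ?_,
      fun _ => rfl⟩⟩
    · exact top_le_iff.1 (le_joinOn (fun _ => (⊤ : B)) (Set.mem_univ PUnit.unit))
    · intro a
      refine UnityPartition.ext (funext fun x => ?_)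
      refine (top_le_iff.1 (a.join_eq_top ▸ joinOn_le_iff.2 fun y _ => ?_)).symm
      exact le_rfl

/-! Both sides of the equivalence amount to preservation of finite limits, which `IsLex` phrases
elementwise: joint measurements exist, jointly injective maps detect equality, and measurements lift
to equalizers. Strong classicality gives the first two, projectivity the third; conversely, under
`IsLex` products and equalizers of elements lie over those of finite sets.

Under `IsLex` any finitely many truth-valued measurements are events of subsets for one common
measurement, and the result of a Boolean operation does not depend on that measurement (`ev_eq_ev`).
Hence `M.Events` inherits the Boolean laws of power sets. Sending `α` to the events of its single
outcomes is natural; it is injective because singleton indicators separate points, and surjective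
because a joint measurement of the members of a partition can be restricted to the outcomes lying in
exactly one member. -/

namespace UnityPartition

/-! ### Partitions of unity -/

variable {B : Type u} [BooleanAlgebra B] {X : Type u} [Finite X]

theorem le_of_forall_disjoint (a : UnityPartition B X) {b : B} {x : X}
    (h : ∀ y, y ≠ x → Disjoint b (a.part y)) : b ≤ a.part x := by
  have hb : b ⊓ joinOn Set.univ a.part = b := by rw [a.join_eq_top, inf_top_eq]
  rw [← hb, joinOn, Finset.sup_inf_distrib_left]
  refine Finset.sup_le fun y _ => ?_
  by_cases hy : y = x
  · exact hy ▸ inf_le_right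
  · exact (h y hy).le_bot.trans bot_le

/-- A family of partitions of unity is ordered discretely. -/
theorem ext_of_le {a b : UnityPartition B X} (h : ∀ x, a.part x ≤ b.part x) : a = b := by
  refine UnityPartition.ext (funext fun x => le_antisymm (h x) ?_)
  exact a.le_of_forall_disjoint fun y hy => (b.disjoint x y hy.symm).mono_right (h y)

theorem part_le_push {Y : Type u} [Finite Y] (f : X → Y) (a : UnityPartition B X) (x : X) :
    a.part x ≤ (a.push f).part (f x) :=
  le_joinOn (s := f ⁻¹' {f x}) a.part rfl

/-- The common refinement of a finite family of partitions of unity. -/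
noncomputable def pi {n : ℕ} {X : Fin n → Type u} [∀ i, Finite (X i)]
    (a : ∀ i, UnityPartition B (X i)) : UnityPartition B (∀ i, X i) where
  part y := Finset.univ.inf fun i => (a i).part (y i)
  disjoint y z hyz := by
    obtain ⟨i, hi⟩ := Function.ne_iff.1 hyz
    exact ((a i).disjoint _ _ hi).mono (Finset.inf_le (Finset.mem_univ i))
      (Finset.inf_le (Finset.mem_univ i))
  join_eq_top := by
    classical
    have h : (Finset.univ.inf fun i => joinOn Set.univ (a i).part) = ⊤ := by
      simp [fun i => (a i).join_eq_top]
    simp only [joinOn] at h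
    -- Distributivity turns the meet of joins into a join over choice functions, which are the
    -- points of the product.
    rw [Finset.inf_sup] at h
    refine top_le_iff.1 (h ▸ Finset.sup_le fun g _ => ?_)
    refine le_trans ?_ (le_joinOn (s := Set.univ) _ (x := fun i => g i (Finset.mem_univ i)) trivial)
    refine Finset.le_inf fun i _ => ?_
    exact Finset.inf_le (s := Finset.univ.attach) (b := ⟨i, Finset.mem_univ i⟩)
      (Finset.mem_attach _ _)

theorem push_pi {n : ℕ} {X : Fin n → Type u} [∀ i, Finite (X i)]
    (a : ∀ i, UnityPartition B (X i)) (i : Fin n) : (pi a).push (fun y => y i) = a i := by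
  refine ext_of_le fun x => joinOn_le_iff.2 ?_
  rintro y rfl
  exact Finset.inf_le (Finset.mem_univ i)

/-- For `y ≠ x` some `p i` separates them, so `a.part x` and `b.part y` lie below distinct members
of one common pushed partition and are disjoint. -/
theorem eq_of_push_eq {ι : Type*} {Y : ι → Type u} [∀ i, Finite (Y i)] (p : ∀ i, X → Y i)
    (hp : ∀ x y, (∀ i, p i x = p i y) → x = y) {a b : UnityPartition B X}
    (h : ∀ i, a.push (p i) = b.push (p i)) : a = b := by
  refine ext_of_le fun x => b.le_of_forall_disjoint fun y hy => ?_
  obtain ⟨i, hi⟩ := not_forall.1 (mt (hp x y) hy.symm)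
  refine ((a.push (p i)).disjoint _ _ hi).mono (a.part_le_push _ x) ?_
  exact h i ▸ b.part_le_push _ y

/-- Where `f x ≠ g x`, the part at `x` lies below two disjoint members of the same partition, so it
is `⊥` and can be dropped. -/
theorem exists_push_val_eq {Y : Type u} [Finite Y] {f g : X → Y} {a : UnityPartition B X}
    (h : a.push f = a.push g) :
    ∃ s : UnityPartition B {x // f x = g x}, s.push Subtype.val = a := by
  have ha : ∀ x, f x ≠ g x → a.part x = ⊥ := fun x hx =>
    disjoint_self.1 (((a.push f).disjoint _ _ hx).mono (a.part_le_push f x)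
      (h ▸ a.part_le_push g x))
  refine ⟨⟨fun x => a.part x, fun x y hxy => a.disjoint _ _ (mt Subtype.ext hxy), ?_⟩, ?_⟩
  · refine top_le_iff.1 (a.join_eq_top ▸ joinOn_le_iff.2 fun x _ => ?_)
    by_cases hx : f x = g x
    · exact le_joinOn (s := Set.univ) (fun x : {x // f x = g x} => a.part x) (x := ⟨x, hx⟩) trivial
    · exact (ha x hx).le.trans bot_le
  · refine ext_of_le fun x => joinOn_le_iff.2 ?_
    rintro y rfl
    exact le_rfl

end UnityPartition

/-! ### Finite-limit preservation -/

namespace GMT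

variable (M : GMT.{u})

theorem push_push {X Y Z : FintypeCat.{u}} (f : X ⟶ Y) (g : Y ⟶ Z) (α : M.Meas X) :
    M.push g (M.push f α) = M.push (f ≫ g) α := by
  simp [push]

theorem push_id {X : FintypeCat.{u}} (α : M.Meas X) : M.push (𝟙 X) α = α := by
  simp [push]

/-- The subset of `X` on which two functions agree. -/
abbrev equalizer {X Y : FintypeCat.{u}} (f g : X ⟶ Y) : FintypeCat.{u} :=
  FintypeCat.of {x : X // f x = g x}

/-- The inclusion of the subset on which two functions agree. -/
abbrev equalizerι {X Y : FintypeCat.{u}} (f g : X ⟶ Y) : equalizer f g ⟶ X :=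
  FintypeCat.homMk Subtype.val

/-- An elementwise form of the preservation of finite limits. -/
class IsLex : Prop where
  exists_joint : ∀ {n : ℕ} (X : Fin n → FintypeCat.{u}) (α : ∀ i, M.Meas (X i)),
    ∃ (Z : FintypeCat.{u}) (δ : M.Meas Z) (p : ∀ i, Z ⟶ X i), ∀ i, M.push (p i) δ = α i
  eq_of_push_eq : ∀ {n : ℕ} {X : Fin n → FintypeCat.{u}} {Z : FintypeCat.{u}} (p : ∀ i, Z ⟶ X i),
    (∀ x y, (∀ i, p i x = p i y) → x = y) → ∀ {α β : M.Meas Z},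
    (∀ i, M.push (p i) α = M.push (p i) β) → α = β
  exists_lift : ∀ {X Y : FintypeCat.{u}} (f g : X ⟶ Y) (α : M.Meas X), M.push f α = M.push g α →
    ∃ σ : M.Meas (equalizer f g), M.push (equalizerι f g) σ = α

instance booleanGMT_isLex (B : Type u) [BooleanAlgebra B] : (booleanGMT B).IsLex where
  exists_joint X α := ⟨FintypeCat.of (∀ i, X i), UnityPartition.pi (X := fun i => X i) α,
    fun i => FintypeCat.homMk fun y => y i, UnityPartition.push_pi (X := fun i => X i) α⟩
  eq_of_push_eq p hp _ _ h :=
    UnityPartition.eq_of_push_eq (fun i z => p i z) hp h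
  exists_lift f g _ h :=
    UnityPartition.exists_push_val_eq (f := fun x => f x) (g := fun x => g x) h

variable {M}

theorem IsLex.of_iso {N : GMT.{u}} [N.IsLex] (e : M.functor ≅ N.functor) : M.IsLex where
  exists_joint X α := by
    obtain ⟨Z, δ, p, h⟩ := IsLex.exists_joint X fun i => e.hom.app (X i) (α i)
    refine ⟨Z, e.inv.app Z δ, p, fun i => ?_⟩
    rw [push, ← NatTrans.naturality_apply, show N.functor.map (p i) δ = _ from h i]
    simp
  eq_of_push_eq p hp α β h := by
    have : e.hom.app _ α = e.hom.app _ β := IsLex.eq_of_push_eq p hp fun i => by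
      rw [push, push, ← NatTrans.naturality_apply, ← NatTrans.naturality_apply]
      exact congrArg _ (h i)
    simpa using congrArg (e.inv.app _) this
  exists_lift f g α h := by
    obtain ⟨σ, hσ⟩ := IsLex.exists_lift (M := N) f g (e.hom.app _ α) (by
      rw [push, push, ← NatTrans.naturality_apply, ← NatTrans.naturality_apply]
      exact congrArg _ h)
    refine ⟨e.inv.app _ σ, ?_⟩
    rw [push, ← NatTrans.naturality_apply, show N.functor.map _ σ = _ from hσ]
    simp

theorem push_injective_of_retraction {X Y : FintypeCat.{u}} {f : X ⟶ Y} {r : Y ⟶ X}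
    (h : f ≫ r = 𝟙 X) : Function.Injective (M.push f) := fun α β hαβ => by
  simpa [push_push, h, push_id] using congrArg (M.push r) hαβ

theorem StronglyClassical.subsingleton_of_isEmpty (hM : M.StronglyClassical) {X : FintypeCat.{u}}
    [IsEmpty X] : Subsingleton (M.Meas X) where
  allEq α β := by
    obtain ⟨Y, f, γ, h, -⟩ := hM 2 (fun _ => X) ![α, β]
    have hf : f 0 = f 1 := FintypeCat.hom_ext _ _ fun y => isEmptyElim (α := X) (f 0 y)
    exact (h 0).trans (hf ▸ (h 1).symm)

/-- The universal `Y` need not be the product of the `X i`. Still, `α` and `β` both map to `γ` over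
the `X i`, so both have the image `M.push k γ` in the product, and a split injection is injective on
measurements. -/
theorem StronglyClassical.eq_of_push_eq (hM : M.StronglyClassical) {n : ℕ}
    {X : Fin n → FintypeCat.{u}} {Z : FintypeCat.{u}} (p : ∀ i, Z ⟶ X i)
    (hp : ∀ x y, (∀ i, p i x = p i y) → x = y) {α β : M.Meas Z}
    (h : ∀ i, M.push (p i) α = M.push (p i) β) : α = β := by
  -- An injection out of the empty set need not have a retraction.
  rcases isEmpty_or_nonempty Z with hZ | hZ
  · exact hM.subsingleton_of_isEmpty.allEq α β
  obtain ⟨Y, f, γ, -, hγ⟩ := hM n X fun i => M.push (p i) α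
  let k : Y ⟶ FintypeCat.of (∀ i, X i) := FintypeCat.homMk fun y i => f i y
  let q : Z ⟶ FintypeCat.of (∀ i, X i) := FintypeCat.homMk fun z i => p i z
  have key : ∀ δ : M.Meas Z, (∀ i, M.push (p i) δ = M.push (p i) α) → M.push q δ = M.push k γ := by
    intro δ hδ
    obtain ⟨m, ⟨hm, hγm⟩, -⟩ := hγ Z δ p hδ
    rw [hγm, push_push]
    congr 1
    refine FintypeCat.hom_ext _ _ fun z => funext fun i => ?_
    exact ConcreteCategory.congr_hom (hm i) z
  have hq : Function.Injective q := fun x y hxy => hp x y fun i => congrFun hxy i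
  refine push_injective_of_retraction (f := q) (r := FintypeCat.homMk (Function.invFun q)) ?_
    ((key α fun _ => rfl).trans (key β fun i => (h i).symm).symm)
  exact FintypeCat.hom_ext _ _ fun z => Function.leftInverse_invFun hq z

theorem isLex_of_stronglyClassical (hM : M.StronglyClassical) (hM' : M.Projective) :
    M.IsLex where
  exists_joint X α := by
    obtain ⟨Y, f, β, h, -⟩ := hM _ X α
    exact ⟨Y, β, f, fun i => (h i).symm⟩
  eq_of_push_eq := hM.eq_of_push_eq
  exists_lift f g α h := by
    obtain ⟨E, σ, e, ⟨he, hσ⟩, -⟩ := hM' _ _ α f g h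
    -- As `e` equalizes `f` and `g`, it factors through the set-theoretic equalizer.
    refine ⟨M.push (FintypeCat.homMk fun x => ⟨e x, ConcreteCategory.congr_hom he x⟩) σ, ?_⟩
    rw [push_push, ← hσ]
    rfl

section IsLex

variable [M.IsLex]

theorem IsLex.stronglyClassical : M.StronglyClassical := by
  intro n X α
  obtain ⟨Z, δ, p, h⟩ := IsLex.exists_joint X α
  let q (i) : FintypeCat.of (∀ i, X i) ⟶ X i := FintypeCat.homMk fun y => y i
  have hq : ∀ i, M.push (q i) (M.push (FintypeCat.homMk fun z i => p i z) δ) = α i := fun i => by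
    rw [push_push, ← h i]
    rfl
  refine ⟨_, q, _, fun i => (hq i).symm, fun W γ g hg => ⟨FintypeCat.homMk fun w i => g i w,
    ⟨fun i => rfl, IsLex.eq_of_push_eq q (fun x y hxy => funext hxy) fun i => ?_⟩, ?_⟩⟩
  · rw [hq, push_push, ← hg]
    rfl
  · rintro k ⟨hk, -⟩
    refine FintypeCat.hom_ext _ _ fun w => funext fun i => ?_
    exact (ConcreteCategory.congr_hom (hk i) w).symm

theorem IsLex.projective : M.Projective := by
  intro X Y α f g h
  obtain ⟨σ, hσ⟩ := IsLex.exists_lift f g α h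
  refine ⟨_, σ, equalizerι f g, ⟨FintypeCat.hom_ext _ _ fun x => x.2, hσ⟩, fun W γ k hk hγ =>
    ⟨FintypeCat.homMk fun w => ⟨k w, ConcreteCategory.congr_hom hk w⟩, ⟨rfl,
      IsLex.eq_of_push_eq (n := 1) (fun _ => equalizerι f g)
        (fun x y hxy => Subtype.ext (hxy 0)) fun _ => ?_⟩, ?_⟩⟩
  · rw [hσ, push_push, ← hγ]
    rfl
  · rintro m ⟨hm, -⟩
    refine FintypeCat.hom_ext _ _ fun w => Subtype.ext ?_
    exact (ConcreteCategory.congr_hom hm w).symm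

end IsLex

/-! ### The Boolean algebra of events -/

/-- The set of truth values, as a finite set in the universe `u`. -/
abbrev truth : FintypeCat.{u} := FintypeCat.of (ULift.{u} Prop)

/-- The indicator function of a subset. -/
abbrev indicator {X : FintypeCat.{u}} (S : Set X) : X ⟶ truth.{u} :=
  FintypeCat.homMk fun x => ⟨x ∈ S⟩

variable (M) in
/-- The truth-valued measurements. -/
abbrev Events : Type u := M.Meas truth.{u}

/-- The event that the outcome of `α` lies in `S`. -/
def ev {X : FintypeCat.{u}} (α : M.Meas X) (S : Set X) : M.Events :=
  M.push (indicator S) α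

theorem ev_push {X Y : FintypeCat.{u}} (f : X ⟶ Y) (α : M.Meas X) (S : Set Y) :
    ev (M.push f α) S = ev α (f ⁻¹' S) :=
  M.push_push f (indicator S) α

variable (M) in
/-- The unique measurement with values in the one-point set. -/
noncomputable def point : M.Meas (FintypeCat.of PUnit.{u + 1}) :=
  M.affine.some.symm PUnit.unit

theorem eq_point (α : M.Meas (FintypeCat.of PUnit.{u + 1})) : α = M.point :=
  M.affine.some.injective rfl

/-- A constant indicator factors through the one-point set, which carries only one measurement. This
makes `⊤` and `⊥` independent of `α`. -/
theorem ev_const {X : FintypeCat.{u}} (α : M.Meas X) (p : Prop) :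
    ev α {_x | p} = ev M.point {_x | p} := by
  rw [← eq_point (M.push (FintypeCat.homMk fun _ => PUnit.unit) α), ev_push]
  rfl

theorem ev_univ {X : FintypeCat.{u}} (α : M.Meas X) : ev α Set.univ = ev M.point Set.univ :=
  ev_const α True

theorem ev_empty {X : FintypeCat.{u}} (α : M.Meas X) : ev α ∅ = ev M.point ∅ :=
  ev_const α False

section IsLex

variable [M.IsLex]

theorem exists_ev_eq {ι : Type*} [Finite ι] (a : ι → M.Events) :
    ∃ (Z : FintypeCat.{u}) (δ : M.Meas Z) (S : ι → Set Z), ∀ i, ev δ (S i) = a i := by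
  obtain ⟨n, ⟨e⟩⟩ := Finite.exists_equiv_fin ι
  obtain ⟨Z, δ, p, h⟩ := IsLex.exists_joint (fun _ => truth) fun i => a (e.symm i)
  refine ⟨Z, δ, fun i => {z | (p (e i) z).down}, fun i => ?_⟩
  have := h (e i)
  rwa [e.symm_apply_apply] at this

theorem eq_of_ev_eq {X : FintypeCat.{u}} {α β : M.Meas X} (h : ∀ x : X, ev α {x} = ev β {x}) :
    α = β := by
  obtain ⟨n, ⟨e⟩⟩ := Finite.exists_equiv_fin X
  refine IsLex.eq_of_push_eq (fun i => indicator {e.symm i}) (fun x y hxy => ?_)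
    fun i => h (e.symm i)
  have h : (x ∈ ({e.symm (e x)} : Set X)) = (y ∈ ({e.symm (e x)} : Set X)) :=
    congrArg ULift.down (hxy (e x))
  rw [e.symm_apply_apply] at h
  exact (h.mp rfl).symm

/-- The pair of truth values has a joint measurement determined by its two marginals, since the
projections are jointly injective. This makes `eventOp` independent of its choices. -/
theorem ev_eq_ev {Z W : FintypeCat.{u}} {δ : M.Meas Z} {γ : M.Meas W} {S T : Set Z} {S' T' : Set W}
    (hS : ev δ S = ev γ S') (hT : ev δ T = ev γ T') (φ : Prop → Prop → Prop) :
    ev δ {z | φ (z ∈ S) (z ∈ T)} = ev γ {z | φ (z ∈ S') (z ∈ T')} := by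
  let P : FintypeCat.{u} := FintypeCat.of (ULift.{u} Prop × ULift.{u} Prop)
  let pr : Fin 2 → (P ⟶ truth.{u}) := ![FintypeCat.homMk Prod.fst, FintypeCat.homMk Prod.snd]
  let u : Z ⟶ P := FintypeCat.homMk fun z => (⟨z ∈ S⟩, ⟨z ∈ T⟩)
  let v : W ⟶ P := FintypeCat.homMk fun z => (⟨z ∈ S'⟩, ⟨z ∈ T'⟩)
  have h : M.push u δ = M.push v γ := by
    refine IsLex.eq_of_push_eq pr (fun x y hxy => Prod.ext (hxy 0) (hxy 1)) fun i => ?_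
    rw [push_push, push_push]
    fin_cases i
    · exact hS
    · exact hT
  have h' := congrArg (fun ε => ev ε {x : P | φ x.1.down x.2.down}) h
  simp only [ev_push] at h'
  exact h'

theorem exists_ev_eq₂ (a b : M.Events) :
    ∃ (Z : FintypeCat.{u}) (δ : M.Meas Z) (S T : Set Z), ev δ S = a ∧ ev δ T = b := by
  obtain ⟨Z, δ, S, h⟩ := exists_ev_eq ![a, b]
  exact ⟨Z, δ, S 0, S 1, h 0, h 1⟩

theorem exists_ev_eq₃ (a b c : M.Events) :
    ∃ (Z : FintypeCat.{u}) (δ : M.Meas Z) (S T U : Set Z), ev δ S = a ∧ ev δ T = b ∧ ev δ U = c := by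
  obtain ⟨Z, δ, S, h⟩ := exists_ev_eq ![a, b, c]
  exact ⟨Z, δ, S 0, S 1, S 2, h 0, h 1, h 2⟩

/-- The operation on events induced by a binary operation on truth values. -/
noncomputable def eventOp (φ : Prop → Prop → Prop) (a b : M.Events) : M.Events :=
  ev (exists_ev_eq₂ a b).choose_spec.choose
    {z | φ (z ∈ (exists_ev_eq₂ a b).choose_spec.choose_spec.choose)
      (z ∈ (exists_ev_eq₂ a b).choose_spec.choose_spec.choose_spec.choose)}

theorem eventOp_ev (φ : Prop → Prop → Prop) {Z : FintypeCat.{u}} (δ : M.Meas Z) (S T : Set Z) :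
    eventOp φ (ev δ S) (ev δ T) = ev δ {z | φ (z ∈ S) (z ∈ T)} :=
  have h := (exists_ev_eq₂ (ev δ S) (ev δ T)).choose_spec.choose_spec.choose_spec.choose_spec
  ev_eq_ev h.1 h.2 φ

theorem eventOp_and {Z : FintypeCat.{u}} (δ : M.Meas Z) (S T : Set Z) :
    eventOp And (ev δ S) (ev δ T) = ev δ (S ∩ T) :=
  eventOp_ev And δ S T

theorem eventOp_or {Z : FintypeCat.{u}} (δ : M.Meas Z) (S T : Set Z) :
    eventOp Or (ev δ S) (ev δ T) = ev δ (S ∪ T) :=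
  eventOp_ev Or δ S T

theorem eventOp_not {Z : FintypeCat.{u}} (δ : M.Meas Z) (S : Set Z) :
    eventOp (fun p _ => ¬p) (ev δ S) (ev δ S) = ev δ Sᶜ :=
  eventOp_ev (fun p _ => ¬p) δ S S

/-- Representing the events involved by subsets for one `δ` reduces each axiom to an identity of
sets. -/
noncomputable instance : BooleanAlgebra M.Events where
  le a b := eventOp And a b = a
  inf := eventOp And
  sup := eventOp Or
  compl a := eventOp (fun p _ => ¬p) a a
  top := ev M.point Set.univ
  bot := ev M.point ∅
  le_refl a := by
    obtain ⟨Z, δ, S, -, rfl, -⟩ := exists_ev_eq₂ a a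
    rw [eventOp_and, Set.inter_self]
  le_trans a b c hab hbc := by
    obtain ⟨Z, δ, S, T, U, rfl, rfl, rfl⟩ := exists_ev_eq₃ a b c
    rw [← hab]
    nth_rw 2 [← hbc]
    simp only [eventOp_and, Set.inter_assoc]
  le_antisymm a b hab hba := by
    obtain ⟨Z, δ, S, T, rfl, rfl⟩ := exists_ev_eq₂ a b
    rw [← hab]
    nth_rw 2 [← hba]
    simp only [eventOp_and, Set.inter_comm]
  inf_le_left a b := by
    obtain ⟨Z, δ, S, T, rfl, rfl⟩ := exists_ev_eq₂ a b
    simp only [eventOp_and, Set.inter_right_comm, Set.inter_self]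
  inf_le_right a b := by
    obtain ⟨Z, δ, S, T, rfl, rfl⟩ := exists_ev_eq₂ a b
    simp only [eventOp_and, Set.inter_assoc, Set.inter_self]
  le_inf a b c hab hac := by
    obtain ⟨Z, δ, S, T, U, rfl, rfl, rfl⟩ := exists_ev_eq₃ a b c
    have h : eventOp And (eventOp And (ev δ S) (ev δ T)) (ev δ U) = ev δ S := by rw [hab, hac]
    simpa only [eventOp_and, Set.inter_assoc] using h
  le_sup_left a b := by
    obtain ⟨Z, δ, S, T, rfl, rfl⟩ := exists_ev_eq₂ a b
    rw [eventOp_or, eventOp_and, Set.inter_eq_left.2 Set.subset_union_left]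
  le_sup_right a b := by
    obtain ⟨Z, δ, S, T, rfl, rfl⟩ := exists_ev_eq₂ a b
    rw [eventOp_or, eventOp_and, Set.inter_eq_left.2 Set.subset_union_right]
  sup_le a b c hac hbc := by
    obtain ⟨Z, δ, S, T, U, rfl, rfl, rfl⟩ := exists_ev_eq₃ a b c
    have h : eventOp Or (eventOp And (ev δ S) (ev δ U)) (eventOp And (ev δ T) (ev δ U)) =
      eventOp Or (ev δ S) (ev δ T) := by rw [hac, hbc]
    simpa only [eventOp_and, eventOp_or, Set.union_inter_distrib_right] using h
  le_sup_inf a b c := by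
    obtain ⟨Z, δ, S, T, U, rfl, rfl, rfl⟩ := exists_ev_eq₃ a b c
    change eventOp And (eventOp And (eventOp Or _ _) (eventOp Or _ _)) (eventOp Or _ (eventOp And _ _)) =
      eventOp And (eventOp Or _ _) (eventOp Or _ _)
    simp only [eventOp_and, eventOp_or, Set.union_inter_distrib_left, Set.inter_self]
  inf_compl_le_bot a := by
    obtain ⟨Z, δ, S, -, rfl, -⟩ := exists_ev_eq₂ a a
    change eventOp And (eventOp And _ (eventOp _ _ _)) _ = eventOp And _ (eventOp _ _ _)
    rw [← ev_empty δ, eventOp_not, eventOp_and, eventOp_and, Set.inter_compl_self, Set.inter_self]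
  top_le_sup_compl a := by
    obtain ⟨Z, δ, S, -, rfl, -⟩ := exists_ev_eq₂ a a
    change eventOp And _ (eventOp Or _ (eventOp _ _ _)) = _
    rw [← ev_univ δ, eventOp_not, eventOp_or, eventOp_and, Set.union_compl_self, Set.inter_self]
  le_top a := by
    obtain ⟨Z, δ, S, -, rfl, -⟩ := exists_ev_eq₂ a a
    rw [← ev_univ δ, eventOp_and, Set.inter_univ]
  bot_le a := by
    obtain ⟨Z, δ, S, -, rfl, -⟩ := exists_ev_eq₂ a a
    rw [← ev_empty δ, eventOp_and, Set.empty_inter]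

/-! ### Measurements as partitions of unity in the events -/

/-- Events of a fixed measurement, as a homomorphism of bounded lattices. -/
noncomputable def evHom {X : FintypeCat.{u}} (α : M.Meas X) :
    BoundedLatticeHom (Set X) M.Events where
  toFun := ev α
  map_sup' S T := (eventOp_or α S T).symm
  map_inf' S T := (eventOp_and α S T).symm
  map_top' := ev_univ α
  map_bot' := ev_empty α

theorem ev_biUnion {X : FintypeCat.{u}} (α : M.Meas X) {I : Type u} [Finite I] (s : Set I)
    (S : I → Set X) : ev α (⋃ i ∈ s, S i) = joinOn s fun i => ev α (S i) := by
  have h := map_finset_sup (evHom α) (Set.toFinite s).toFinset S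
  rw [Finset.sup_set_eq_biUnion] at h
  simp only [Set.Finite.mem_toFinset] at h
  exact h

theorem ev_singleton_preimage {X Y : FintypeCat.{u}} (f : X ⟶ Y) (α : M.Meas X) (y : Y) :
    ev (M.push f α) {y} = joinOn (f ⁻¹' {y}) fun x => ev α {x} := by
  rw [← ev_biUnion, Set.biUnion_of_singleton, ev_push]

/-- The partition of unity formed by the events of the single outcomes of a measurement. -/
noncomputable def toPartition {X : FintypeCat.{u}} (α : M.Meas X) :
    UnityPartition M.Events X where
  part x := ev α {x}
  disjoint x y hxy := by
    rw [disjoint_iff]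
    have h : ({x} : Set X) ∩ {y} = ∅ :=
      Set.singleton_inter_eq_empty.2 (Set.notMem_singleton_iff.2 hxy)
    refine (map_inf (evHom α) ({x} : Set X) {y}).symm.trans ((congrArg (ev α) h).trans ?_)
    exact ev_empty α
  join_eq_top := by
    rw [← ev_biUnion, Set.biUnion_of_singleton]
    exact ev_univ α

theorem toPartition_injective (X : FintypeCat.{u}) :
    Function.Injective (toPartition (M := M) (X := X)) := fun _ _ h =>
  eq_of_ev_eq fun x => congrFun (congrArg UnityPartition.part h) x

/-- The hypothesis says that the indicators of `S` and of the whole set push `δ` to the same event;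
their equalizer is `S`. -/
theorem exists_lift_of_ev_eq_top {Z : FintypeCat.{u}} (δ : M.Meas Z) (S : Set Z)
    (h : ev δ S = ⊤) :
    ∃ σ : M.Meas (FintypeCat.of S), M.push (FintypeCat.homMk Subtype.val) σ = δ := by
  obtain ⟨σ, hσ⟩ := IsLex.exists_lift (indicator S) (indicator Set.univ) δ
    (h.trans (ev_univ δ).symm)
  refine ⟨M.push (FintypeCat.homMk fun z : equalizer (indicator S) (indicator Set.univ) =>
    (⟨z.1, of_eq_true ((congrArg ULift.down z.2).trans (eq_true trivial))⟩ : S)) σ, ?_⟩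
  rw [push_push, ← hσ]
  rfl

theorem toPartition_surjective (X : FintypeCat.{u}) :
    Function.Surjective (toPartition (M := M) (X := X)) := by
  intro b
  obtain ⟨Z, δ, S, h⟩ := exists_ev_eq b.part
  have hcover : ev δ (⋃ x ∈ (Set.univ : Set X), S x) = ⊤ := by
    simp only [ev_biUnion, h, b.join_eq_top]
  have hoverlap : ev δ (⋃ i ∈ {i : X × X | i.1 ≠ i.2}, S i.1 ∩ S i.2) = ⊥ := by
    rw [ev_biUnion]
    refine le_bot_iff.1 (joinOn_le_iff.2 fun i hi => ?_)
    have := (b.disjoint i.1 i.2 hi).le_bot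
    rw [← h, ← h] at this
    exact (map_inf (evHom δ) _ _).le.trans this
  -- The union of the `S x` has event `⊤` and is contained in this set together with the overlaps,
  -- whose event is `⊥`.
  have hE : ev δ {z | ∃! x, z ∈ S x} = ⊤ := by
    refine top_le_iff.1 (hcover ▸ ?_)
    refine le_trans ?_ (sup_le le_rfl (hoverlap.le.trans bot_le))
    refine le_trans ?_ (map_sup (evHom δ) _ _).le
    refine OrderHomClass.mono (evHom δ) fun z hz => ?_
    obtain ⟨x, -, hx⟩ := Set.mem_iUnion₂.1 hz
    by_cases hu : ∃! x, z ∈ S x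
    · exact Or.inl hu
    · obtain ⟨y, hy, hyx⟩ : ∃ y, z ∈ S y ∧ y ≠ x := by
        by_contra! hc
        exact hu ⟨x, hx, hc⟩
      exact Or.inr (Set.mem_iUnion₂.2 ⟨(y, x), hyx, hy, hx⟩)
  obtain ⟨σ, hσ⟩ := exists_lift_of_ev_eq_top δ _ hE
  -- The preimage of `{x}` under the unique-index map is the trace of `S x`.
  refine ⟨M.push (FintypeCat.homMk fun z : {z | ∃! x, z ∈ S x} => z.2.choose) σ, UnityPartition.ext (funext fun x => ?_)⟩
  refine (ev_push _ _ _).trans ?_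
  rw [← h x, ← hσ, ev_push]
  congr 1
  ext z
  refine ⟨?_, fun hz => (z.2.choose_spec.2 x hz).symm⟩
  rintro rfl
  exact z.2.choose_spec.1

/-- A GMT that preserves finite limits is the GMT of its Boolean algebra of events. -/
theorem isomorphic_booleanGMT : M.Isomorphic (booleanGMT M.Events) := by
  let τ : M.functor ⟶ (booleanGMT M.Events).functor :=
    { app := fun X => TypeCat.ofHom (toPartition (X := X))
      naturality := fun X Y f => by
        apply ConcreteCategory.hom_ext
        intro α
        exact UnityPartition.ext (funext fun y => ev_singleton_preimage f α y) }
  have : ∀ X, IsIso (τ.app X) := fun X =>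
    (isIso_iff_bijective _).2 ⟨toPartition_injective X, toPartition_surjective X⟩
  have := NatIso.isIso_of_isIso_app τ
  exact ⟨asIso τ⟩

end IsLex

end GMT

theorem mainTheorem2 (M : GMT.{u}) :
    (M.StronglyClassical ∧ M.Projective) ↔
      ∃ (B : Type u) (_ : BooleanAlgebra B), M.Isomorphic (booleanGMT B) := by
  constructor
  · rintro ⟨h, h'⟩
    have := GMT.isLex_of_stronglyClassical h h'
    exact ⟨M.Events, inferInstance, GMT.isomorphic_booleanGMT⟩
  · rintro ⟨B, _, ⟨e⟩⟩
    have := GMT.IsLex.of_iso e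
    exact ⟨GMT.IsLex.stronglyClassical, GMT.IsLex.projective⟩
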